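/- **Terms.** Let $P$ be an infinite set of constants, called stack constants. We consider the terms built from $\lambda$-variables, a constant $C$ and the stack constants by abstraction and application, up to renaming of bound variables; a $\lambda C$-term is such a term without stack constants. We write $(t)u_1\dots u_k$ for $(\dots((t)u_1)\dots)u_k$. Let $\succ_C$ be the reflexive transitive closure of head $C$-reduction, which is given by the following two rules, applied to whole terms only (with $k\ge 0$): $$(\lambda x\,u)\,t\,t_1\dots t_k \to (u[t/x])\,t_1\dots t_k ,\qquad (C)\,t\,t_1\dots t_k \to (t)\,\lambda x\,(x)\,t_1\dots t_k\quad (x \text{ not free in } t_1,\dots,t_k).$$ **Types.** Fix a language with a constant symbol $0$ and a unary function symbol $s$. The types are the formulas of second order predicate logic over this language, built from $\bot$ and atomic formulas by $\to$ and by $\forall$ over individual variables and over predicate variables of every arity; $\neg A$ is $A\to\bot$, and $A_1,\dots,A_k\to B$ is $A_1\to(\dots\to(A_k\to B)\dots)$. Fix also a set $E$ of equations between individual terms, and write $a\approx b$ if $a=b$ is a consequence of $E$ (the variables of the equations in $E$ being universally quantified). Assume that $E$ is adequate with the type of integers: for all individual terms $a,b$, $s(a)\not\approx 0$, and $s(a)\approx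 s(b)$ implies $a\approx b$. The system $C2$ derives judgements $\Gamma\vdash_{C2} t:A$ by the rules: - $\Gamma\vdash C:\forall X\{\neg\neg X\to X\}$ ($X$ of arity $0$); - $\Gamma\vdash x:A$ if $x:A$ is in $\Gamma$; - if $\Gamma,x:A\vdash t:B$, then $\Gamma\vdash\lambda x\,t:A\to B$; - if $\Gamma\vdash u:A\to B$ and $\Gamma\vdash v:A$, then $\Gamma\vdash (u)v:B$; - if $\Gamma\vdash t:A$ and the individual variable $y$ (resp. the predicate variable $X$) is not free in $\Gamma$, then $\Gamma\vdash t:\forall y\,A$ (resp. $\Gamma\vdash t:\forall X\,A$); - if $\Gamma\vdash t:\forall y\,A$, then $\Gamma\vdash t:A[a/y]$ for every individual term $a$; if $\Gamma\vdash t:\forall X\,A$, then $\Gamma\vdash t:A[G/X]$ for every formula $G$ (with distinguished parameters matching the arity of $X$); - if $\Gamma\vdash t:A[a/y]$ and $a\approx b$, then $\Gamma\vdash t:A[b/y]$. Let $N[a]=\forall X\{X(0),\ \forall y\,(X(y)\to X(s(y)))\to X(a)\}$ with $X$ a unary predicate variable. For $n\in\mathbb N$, a classical integer of value $n$ is a closed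 $\lambda C$-term $\theta_n$ such that $\vdash_{C2}\theta_n:N[s^n(0)]$. **Theorem.** Let $n\in\mathbb N$, let $\theta_n$ be a classical integer of value $n$, and let $x,g$ be two distinct $\lambda$-variables. - If $n=0$, then $(\theta_n)\,x\,g\,p\succ_C (x)\,p$ for every stack constant $p$. - If $n\neq 0$, then there are $m\ge 1$, a mapping $I:\{0,\dots,m\}\to\mathbb N$ and indices $r_0,\dots,r_m\in\{0,\dots,m\}$ with $$I(0)=n,\qquad I(r_m)=0,\qquad I(r_i)\ge 1\ \text{ and }\ I(i+1)=I(r_i)-1\quad (0\le i\le m-1),$$ such that for all distinct stack constants $p_0,p_1,\dots,p_m$ there are terms $t_1,\dots,t_m$ (which may contain stack constants) with $$(\theta_n)\,x\,g\,p_0\succ_C (g)\,t_1\,p_{r_0},$$ $$(t_i)\,p_i\succ_C (g)\,t_{i+1}\,p_{r_i}\qquad (1\le i\le m-1),$$ $$(t_m)\,p_m\succ_C (x)\,p_{r_m}.$$ -/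

import Mathlib

universe u v w

namespace MixedLogic

/-! ## Terms: the λC-calculus with stack constants, in de Bruijn notation -/

/-- Terms built from λ-variables, the constant `C`, stack constants taken from `P`, abstraction and
application.  In `lam t` the variable `0` of `t` is bound.  The λC-terms proper are those without
stack constants, see `Tm.StackFree`. -/
inductive Tm (P : Type w) : Type w
  | var (i : ℕ) : Tm P
  | C : Tm P
  | stk (p : P) : Tm P
  | lam (t : Tm P) : Tm P
  | app (t s : Tm P) : Tm P

namespace Tm

variable {P : Type w}

/-- Extension of a renaming under one λ. -/
def liftRen (ρ : ℕ → ℕ) : ℕ → ℕ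
  | 0 => 0
  | i + 1 => ρ i + 1

/-- Renaming of the free variables. -/
def rename : Tm P → (ℕ → ℕ) → Tm P
  | var i, ρ => var (ρ i)
  | C, _ => C
  | stk p, _ => stk p
  | lam t, ρ => lam (t.rename (liftRen ρ))
  | app t s, ρ => app (t.rename ρ) (s.rename ρ)

/-- Extension of a substitution under one λ. -/
def liftSub (σ : ℕ → Tm P) : ℕ → Tm P
  | 0 => var 0
  | i + 1 => (σ i).rename Nat.succ

/-- Simultaneous capture-avoiding substitution for the free variables. -/
def subst : Tm P → (ℕ → Tm P) → Tm P
  | var i, σ => σ i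
  | C, _ => C
  | stk p, _ => stk p
  | lam t, σ => lam (t.subst (liftSub σ))
  | app t s, σ => app (t.subst σ) (s.subst σ)

/-- `u[t/x]`, where `x` is the variable of `u` with index `0`. -/
def inst (u t : Tm P) : Tm P :=
  u.subst fun i => match i with
    | 0 => t
    | j + 1 => var j

/-- `(t)t₁…tₙ`. -/
def apps (t : Tm P) (ts : List (Tm P)) : Tm P :=
  ts.foldl app t

/-- All free variables have an index below `k`; in particular `ClosedAt 0` means closed. -/
def ClosedAt : Tm P → ℕ → Prop
  | var i, k => i < k
  | C, _ => True
  | stk _, _ => True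
  | lam t, k => t.ClosedAt (k + 1)
  | app t s, k => t.ClosedAt k ∧ s.ClosedAt k

/-- No stack constant occurs: the term is a λC-term. -/
def StackFree : Tm P → Prop
  | var _ => True
  | C => True
  | stk _ => False
  | lam t => t.StackFree
  | app t s => t.StackFree ∧ s.StackFree

/-- One step of head C-reduction:
`(λx u) t t₁ … tₙ → (u[t/x]) t₁ … tₙ` and `(C) t t₁ … tₙ → (t) λx (x) t₁ … tₙ`
with `x` not occurring in `t₁, …, tₙ`. The rules apply to the whole term only. -/
inductive HeadStep : Tm P → Tm P → Prop
  | beta (u t : Tm P) (ts : List (Tm P)) :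
      HeadStep (apps (app (lam u) t) ts) (apps (inst u t) ts)
  | ctrl (t : Tm P) (ts : List (Tm P)) :
      HeadStep (apps (app C t) ts)
        (app t (lam (apps (var 0) (ts.map fun s => s.rename Nat.succ))))

/-- `t ≻_C t'`: finitely many (possibly zero) steps of head C-reduction. -/
def HeadRed : Tm P → Tm P → Prop :=
  Relation.ReflTransGen HeadStep

end Tm

/-! ## Types: formulas of second order predicate logic over a language -/

/-- Formulas of second order logic built with `⊥`, `→` and `∀`.  Individual terms are
`L.Term ℕ`.  The variables are de Bruijn indices: individual variables are numbered by `ℕ`, and for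
each arity `n` the `n`-ary predicate variables are numbered by `ℕ`.
`all1` binds the individual variable `0`; `all2 n` binds the `n`-ary predicate variable `0`. -/
inductive Ty (L : FirstOrder.Language.{u, v}) : Type (max u v)
  | bot : Ty L
  | rel {n : ℕ} (R : L.Relations n) (ts : Fin n → L.Term ℕ) : Ty L
  | pvar {n : ℕ} (X : ℕ) (ts : Fin n → L.Term ℕ) : Ty L
  | imp (A B : Ty L) : Ty L
  | all1 (A : Ty L) : Ty L
  | all2 (n : ℕ) (A : Ty L) : Ty L

namespace Ty

variable {L : FirstOrder.Language.{u, v}}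

/-- `¬A` is `A → ⊥`. -/
def neg (A : Ty L) : Ty L :=
  imp A bot

/-- Extension of an individual substitution under one individual quantifier. -/
def liftI (τ : ℕ → L.Term ℕ) : ℕ → L.Term ℕ
  | 0 => FirstOrder.Language.Term.var 0
  | i + 1 => (τ i).relabel Nat.succ

/-- Simultaneous capture-avoiding substitution of individual terms for individual variables. -/
def isubst : Ty L → (ℕ → L.Term ℕ) → Ty L
  | bot, _ => bot
  | rel R ts, τ => rel R fun i => (ts i).subst τ
  | pvar X ts, τ => pvar X fun i => (ts i).subst τ
  | imp A B, τ => imp (A.isubst τ) (B.isubst τ)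
  | all1 A, τ => all1 (A.isubst (liftI τ))
  | all2 n A, τ => all2 n (A.isubst τ)

/-- The weakening of a formula by a new individual variable `0`. -/
def ishift (A : Ty L) : Ty L :=
  A.isubst fun i => FirstOrder.Language.Term.var (i + 1)

/-- `A[u/x]`, where `x` is the individual variable with index `0`. -/
def inst1 (A : Ty L) (a : L.Term ℕ) : Ty L :=
  A.isubst fun i => match i with
    | 0 => a
    | j + 1 => FirstOrder.Language.Term.var j

/-- The renaming of predicate variables (by arity and index) that makes room for a new `n`-ary
predicate variable `0`. -/
def succP (n : ℕ) : ℕ → ℕ → ℕ :=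
  fun m k => if m = n then k + 1 else k

/-- Extension of a renaming of predicate variables under `all2 n`. -/
def liftRenP (n : ℕ) (ρ : ℕ → ℕ → ℕ) : ℕ → ℕ → ℕ :=
  fun m k => if m = n then
      match k with
      | 0 => 0
      | j + 1 => ρ m j + 1
    else ρ m k

/-- Renaming of the free predicate variables. -/
def prename : Ty L → (ℕ → ℕ → ℕ) → Ty L
  | bot, _ => bot
  | rel R ts, _ => rel R ts
  | @pvar _ n X ts, ρ => pvar (ρ n X) ts
  | imp A B, ρ => imp (A.prename ρ) (B.prename ρ)
  | all1 A, ρ => all1 (A.prename ρ)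
  | all2 n A, ρ => all2 n (A.prename (liftRenP n ρ))

/-- The weakening of a formula by a new `n`-ary predicate variable `0`. -/
def pshift (n : ℕ) (A : Ty L) : Ty L :=
  A.prename (succP n)

/-! An `n`-ary predicate `λx₀…xₙ₋₁ G` is represented by a formula `G` in which the individual
variables `0, …, n - 1` are the parameters and `n + j` stands for the free individual variable `j`
of the predicate. -/

/-- The formula `G[ts/x₀,…,xₙ₋₁]` obtained by applying the predicate `λx₀…xₙ₋₁ G` to `ts`. -/
def applyP {n : ℕ} (G : Ty L) (ts : Fin n → L.Term ℕ) : Ty L :=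
  G.isubst fun i => if h : i < n then ts ⟨i, h⟩ else FirstOrder.Language.Term.var (i - n)

/-- The `n`-ary predicate variable `X`, seen as the predicate `λx₀…xₙ₋₁ X(x₀,…,xₙ₋₁)`. -/
def idP (n X : ℕ) : Ty L :=
  pvar X fun i : Fin n => FirstOrder.Language.Term.var (i : ℕ)

/-- Extension of a substitution of predicates for predicate variables under `all1`: the free
individual variables of the predicates are shifted, their parameters are not. -/
def liftP1 (σ : ℕ → ℕ → Ty L) : ℕ → ℕ → Ty L :=
  fun m k => (σ m k).isubst fun i => FirstOrder.Language.Term.var (if i < m then i else i + 1)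

/-- Extension of a substitution of predicates for predicate variables under `all2 n`. -/
def liftP2 (n : ℕ) (σ : ℕ → ℕ → Ty L) : ℕ → ℕ → Ty L :=
  fun m k => if m = n then
      match k with
      | 0 => idP m 0
      | j + 1 => (σ m j).pshift n
    else (σ m k).pshift n

/-- Simultaneous capture-avoiding substitution: the `m`-ary predicate variable `k` is replaced by
the `m`-ary predicate `σ m k`. -/
def psubst : Ty L → (ℕ → ℕ → Ty L) → Ty L
  | bot, _ => bot
  | rel R ts, _ => rel R ts
  | @pvar _ n X ts, σ => (σ n X).applyP ts
  | imp A B, σ => imp (A.psubst σ) (B.psubst σ)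
  | all1 A, σ => all1 (A.psubst (liftP1 σ))
  | all2 n A, σ => all2 n (A.psubst (liftP2 n σ))

/-- `A[G/X]`, where `X` is the `n`-ary predicate variable with index `0` and `G` represents an
`n`-ary predicate. -/
def inst2 (n : ℕ) (A G : Ty L) : Ty L :=
  A.psubst fun m k => if m = n then
      match k with
      | 0 => G
      | j + 1 => idP m j
    else idP m k

end Ty

/-! ## Equations -/

variable {L : FirstOrder.Language.{u, v}}

/-- `a ≈ b`: the equation `a = b` is a consequence of the set `E` of equations, whose variables are
understood as universally quantified (equational deduction). -/
inductive EqCons (E : Set (L.Term ℕ × L.Term ℕ)) : L.Term ℕ → L.Term ℕ → Prop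
  | ax {a b : L.Term ℕ} (h : (a, b) ∈ E) (τ : ℕ → L.Term ℕ) : EqCons E (a.subst τ) (b.subst τ)
  | refl (a : L.Term ℕ) : EqCons E a a
  | symm {a b : L.Term ℕ} : EqCons E a b → EqCons E b a
  | trans {a b c : L.Term ℕ} : EqCons E a b → EqCons E b c → EqCons E a c
  | func {n : ℕ} (f : L.Functions n) {as bs : Fin n → L.Term ℕ} :
      (∀ i, EqCons E (as i) (bs i)) →
        EqCons E (FirstOrder.Language.Term.func f as) (FirstOrder.Language.Term.func f bs)

/-- The set of equations `E` is adequate with the type of integers, for the constant symbol `zero`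
and the unary function symbol `succ`. -/
def Adequate (zero : L.Constants) (succ : L.Functions 1) (E : Set (L.Term ℕ × L.Term ℕ)) : Prop :=
  (∀ a : L.Term ℕ, ¬ EqCons E (succ.apply₁ a) zero.term) ∧
    ∀ a b : L.Term ℕ, EqCons E (succ.apply₁ a) (succ.apply₁ b) → EqCons E a b

/-! ## The type system C2 -/

/-- `∀X {¬¬X → X}`, with `X` a `0`-ary predicate variable. -/
def dne : Ty L :=
  Ty.all2 0 (Ty.imp (Ty.neg (Ty.neg (Ty.idP 0 0))) (Ty.idP 0 0))

/-- `Γ ⊢_{C2} t : A` with respect to the set `E` of equations. The context is a list: the variable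
`i` has the `i`-th type of the list. Stack constants are not typable. -/
inductive TypedC2 {P : Type w} (E : Set (L.Term ℕ × L.Term ℕ)) :
    List (Ty L) → Tm P → Ty L → Prop
  | ctrl (Γ : List (Ty L)) : TypedC2 E Γ Tm.C dne
  | var {Γ : List (Ty L)} {i : ℕ} {A : Ty L} : Γ[i]? = some A → TypedC2 E Γ (Tm.var i) A
  | lam {Γ : List (Ty L)} {t : Tm P} {A B : Ty L} :
      TypedC2 E (A :: Γ) t B → TypedC2 E Γ (Tm.lam t) (Ty.imp A B)
  | app {Γ : List (Ty L)} {t s : Tm P} {A B : Ty L} :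
      TypedC2 E Γ t (Ty.imp A B) → TypedC2 E Γ s A → TypedC2 E Γ (Tm.app t s) B
  | all1_intro {Γ : List (Ty L)} {t : Tm P} {A : Ty L} :
      TypedC2 E (Γ.map Ty.ishift) t A → TypedC2 E Γ t (Ty.all1 A)
  | all1_elim {Γ : List (Ty L)} {t : Tm P} {A : Ty L} (a : L.Term ℕ) :
      TypedC2 E Γ t (Ty.all1 A) → TypedC2 E Γ t (A.inst1 a)
  | all2_intro {Γ : List (Ty L)} {t : Tm P} {n : ℕ} {A : Ty L} :
      TypedC2 E (Γ.map (Ty.pshift n)) t A → TypedC2 E Γ t (Ty.all2 n A)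
  | all2_elim {Γ : List (Ty L)} {t : Tm P} {n : ℕ} {A : Ty L} (G : Ty L) :
      TypedC2 E Γ t (Ty.all2 n A) → TypedC2 E Γ t (Ty.inst2 n A G)
  | eqn {Γ : List (Ty L)} {t : Tm P} {A : Ty L} {a b : L.Term ℕ} :
      EqCons E a b → TypedC2 E Γ t (A.inst1 a) → TypedC2 E Γ t (A.inst1 b)

/-! ## Integers -/

/-- The individual term `sⁿ(0)`. -/
def numeral (zero : L.Constants) (succ : L.Functions 1) : ℕ → L.Term ℕ
  | 0 => zero.term
  | n + 1 => succ.apply₁ (numeral zero succ n)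

/-- The formula `X(a)`, with `X` the unary predicate variable with index `0`. -/
def predX (a : L.Term ℕ) : Ty L :=
  Ty.pvar 0 fun _ : Fin 1 => a

/-- The type of integers `N[a] = ∀X {X(0), ∀y (X(y) → X(s(y))) → X(a)}`. -/
def natTy (zero : L.Constants) (succ : L.Functions 1) (a : L.Term ℕ) : Ty L :=
  Ty.all2 1 (Ty.imp (predX zero.term)
    (Ty.imp
      (Ty.all1 (Ty.imp (predX (FirstOrder.Language.Term.var 0))
        (predX (succ.apply₁ (FirstOrder.Language.Term.var 0)))))
      (predX a)))

/-- `θ` is a classical integer of value `n`: a closed λC-term of type `N[sⁿ(0)]` in C2. -/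
def IsClassicalInteger {P : Type w} (zero : L.Constants) (succ : L.Functions 1)
    (E : Set (L.Term ℕ × L.Term ℕ)) (n : ℕ) (θ : Tm P) : Prop :=
  θ.StackFree ∧ θ.ClosedAt 0 ∧ TypedC2 E [] θ (natTy zero succ (numeral zero succ n))

end MixedLogic

/-! The proof is by classical realizability. Individuals are the terms modulo `E`, and a formula
denotes a set of stacks relative to a pole of terms closed under head expansion. Every typing rule
is sound (`TypedC2.realizes`). The constant $C$ realizes $\neg\neg X\to X$ because $\lambda
x\,(x)\pi$ restores the stack $\pi$.

Give each stack constant a value and a label. The pole `Countdown` consists of the terms that reach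
$(x)p$ with $p$ of value $0$, or $(g)\,s\,p$ with $p$ of value $k+1$ such that $(s)p'$ is again in
the pole for every $p'$ of value $k$. Let $X(a)$ denote the one-element stacks $p$ whose value $k$
satisfies $a\approx s^k(0)$. Then $x$ realizes $X(0)$ and, by adequacy of $E$, $g$ realizes $\forall
y(X(y)\to X(s(y)))$; hence $(\theta_n)\,x\,g\,p$ is in the pole when $p$ has value $n$
(`TypedC2.countdown`).

`Countdown` is inductive, so choosing a fresh label at each call of $g$ gives a finite run.
Reduction creates no stack constant, so each constant received was introduced earlier; this defines
$r$, and $I$ records the values (`Countdown.exists_run`). Reduction commutes with replacing stack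
constants, so one labelled run yields the runs for all $p_0,\dots,p_m$ with the same $I$ and $r$. -/

namespace MixedLogic

/-! ### Substitution calculus of λC-terms -/

namespace Tm

variable {P : Type*} {Q : Type*}

theorem liftRen_comp (ρ ρ' : ℕ → ℕ) :
    (fun i => liftRen ρ' (liftRen ρ i)) = liftRen fun i => ρ' (ρ i) := by
  funext i; cases i <;> rfl

theorem rename_rename (t : Tm P) (ρ ρ' : ℕ → ℕ) :
    (t.rename ρ).rename ρ' = t.rename fun i => ρ' (ρ i) := by
  induction t generalizing ρ ρ' with
  | lam t ih => simp [rename, ih, liftRen_comp]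
  | app t s iht ihs => simp [rename, iht, ihs]
  | _ => rfl

theorem liftSub_comp_liftRen (ρ : ℕ → ℕ) (σ : ℕ → Tm P) :
    (fun i => liftSub σ (liftRen ρ i)) = liftSub fun i => σ (ρ i) := by
  funext i; cases i <;> rfl

theorem subst_rename (t : Tm P) (ρ : ℕ → ℕ) (σ : ℕ → Tm P) :
    (t.rename ρ).subst σ = t.subst fun i => σ (ρ i) := by
  induction t generalizing ρ σ with
  | lam t ih => simp [rename, subst, ih, liftSub_comp_liftRen]
  | app t s iht ihs => simp [rename, subst, iht, ihs]
  | _ => rfl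

theorem rename_liftSub (ρ : ℕ → ℕ) (σ : ℕ → Tm P) :
    (fun i => (liftSub σ i).rename (liftRen ρ)) = liftSub fun i => (σ i).rename ρ := by
  funext i
  cases i with
  | zero => rfl
  | succ i => simp [liftSub, rename_rename, liftRen]

theorem rename_subst (t : Tm P) (σ : ℕ → Tm P) (ρ : ℕ → ℕ) :
    (t.subst σ).rename ρ = t.subst fun i => (σ i).rename ρ := by
  induction t generalizing ρ σ with
  | lam t ih => simp [rename, subst, ih, rename_liftSub]
  | app t s iht ihs => simp [rename, subst, iht, ihs]
  | _ => rfl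

theorem subst_liftSub (σ σ' : ℕ → Tm P) :
    (fun i => (liftSub σ i).subst (liftSub σ')) = liftSub fun i => (σ i).subst σ' := by
  funext i
  cases i with
  | zero => rfl
  | succ i => simp [liftSub, subst_rename, rename_subst]

theorem subst_subst (t : Tm P) (σ σ' : ℕ → Tm P) :
    (t.subst σ).subst σ' = t.subst fun i => (σ i).subst σ' := by
  induction t generalizing σ σ' with
  | lam t ih => simp [subst, ih, subst_liftSub]
  | app t s iht ihs => simp [subst, iht, ihs]
  | _ => rfl

theorem liftSub_var : liftSub (var : ℕ → Tm P) = var := by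
  funext i; cases i <;> rfl

theorem subst_var (t : Tm P) : t.subst var = t := by
  induction t with
  | lam t ih => simp [subst, liftSub_var, ih]
  | app t s iht ihs => simp [subst, iht, ihs]
  | _ => rfl

/-- Extension of a substitution by a term for the variable `0`. -/
def consSub (s : Tm P) (σ : ℕ → Tm P) : ℕ → Tm P
  | 0 => s
  | i + 1 => σ i

theorem inst_eq (u t : Tm P) : inst u t = u.subst (consSub t var) := by
  unfold inst
  congr 1

theorem inst_rename_succ (s u : Tm P) : inst (s.rename Nat.succ) u = s := by
  rw [inst_eq, subst_rename]
  exact subst_var s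

/-- The form of the β-step needed for the abstraction rule in `TypedC2.realizes`. -/
theorem inst_subst_liftSub (u s : Tm P) (σ : ℕ → Tm P) :
    inst (u.subst (liftSub σ)) s = u.subst (consSub s σ) := by
  rw [inst_eq, subst_subst]
  congr 1
  funext i
  cases i with
  | zero => rfl
  | succ i =>
    simp only [liftSub, ← inst_eq, inst_rename_succ]
    rfl

theorem subst_apps (t : Tm P) (ts : List (Tm P)) (σ : ℕ → Tm P) :
    (apps t ts).subst σ = apps (t.subst σ) (ts.map fun s => s.subst σ) := by
  induction ts generalizing t with
  | nil => rfl
  | cons s ts ih => exact ih (app t s)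

theorem inst_continuation (ts : List (Tm P)) (u : Tm P) :
    inst (apps (var 0) (ts.map fun s => s.rename Nat.succ)) u = apps u ts := by
  rw [inst, subst_apps, List.map_map]
  congr 1
  conv_rhs => rw [← List.map_id ts]
  exact List.map_congr_left fun s _ => inst_rename_succ s u

/-! ### Replacing and tracking stack constants -/

/-- Replacement of the stack constants. -/
def map (f : P → Q) : Tm P → Tm Q
  | var i => var i
  | C => C
  | stk p => stk (f p)
  | lam t => lam (t.map f)
  | app t s => app (t.map f) (s.map f)

theorem map_rename (f : P → Q) (t : Tm P) (ρ : ℕ → ℕ) :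
    (t.rename ρ).map f = (t.map f).rename ρ := by
  induction t generalizing ρ with
  | lam t ih => simp [rename, map, ih]
  | app t s iht ihs => simp [rename, map, iht, ihs]
  | _ => rfl

theorem map_liftSub (f : P → Q) (σ : ℕ → Tm P) :
    (fun i => (liftSub σ i).map f) = liftSub fun i => (σ i).map f := by
  funext i
  cases i with
  | zero => rfl
  | succ i => simp [liftSub, map_rename]

theorem map_subst (f : P → Q) (t : Tm P) (σ : ℕ → Tm P) :
    (t.subst σ).map f = (t.map f).subst fun i => (σ i).map f := by
  induction t generalizing σ with
  | lam t ih => simp [subst, map, ih, map_liftSub]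
  | app t s iht ihs => simp [subst, map, iht, ihs]
  | _ => rfl

theorem map_inst (f : P → Q) (u t : Tm P) : (inst u t).map f = inst (u.map f) (t.map f) := by
  rw [inst_eq, inst_eq, map_subst]
  congr 1
  funext i
  cases i <;> rfl

theorem map_apps (f : P → Q) (t : Tm P) (ts : List (Tm P)) :
    (apps t ts).map f = apps (t.map f) (ts.map (map f)) := by
  induction ts generalizing t with
  | nil => rfl
  | cons s ts ih => exact ih (app t s)

/-- Lets `θ` be run with labelled constants and then be recovered over `P`. -/
theorem map_map_of_stackFree (f : P → Q) (h : Q → P) {t : Tm P} (ht : t.StackFree) :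
    (t.map f).map h = t := by
  induction t with
  | stk p => exact ht.elim
  | lam t ih => simp only [map, ih ht]
  | app t s iht ihs => simp only [map, iht ht.1, ihs ht.2]
  | _ => rfl

/-- Neither reduction rule inspects a stack constant. -/
theorem HeadStep.map (f : P → Q) {t t' : Tm P} (h : HeadStep t t') :
    HeadStep (t.map f) (t'.map f) := by
  cases h with
  | beta u t ts =>
    rw [map_apps, map_apps, map_inst]
    exact .beta _ _ _
  | ctrl t ts =>
    have := HeadStep.ctrl (t.map f) (ts.map (Tm.map f))
    rw [map_apps]
    simpa [Tm.map, map_apps, List.map_map, Function.comp_def, map_rename] using this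

theorem HeadRed.map (f : P → Q) {t t' : Tm P} (h : HeadRed t t') :
    HeadRed (t.map f) (t'.map f) := by
  induction h with
  | refl => exact .refl
  | tail _ h ih => exact ih.tail (h.map f)

/-- All stack constants of the term belong to `S`. -/
def StacksIn (S : Set P) : Tm P → Prop
  | var _ => True
  | C => True
  | stk p => p ∈ S
  | lam t => t.StacksIn S
  | app t s => t.StacksIn S ∧ s.StacksIn S

theorem StacksIn.mono {S S' : Set P} (hS : S ⊆ S') {t : Tm P} (ht : t.StacksIn S) :
    t.StacksIn S' := by
  induction t with
  | stk p => exact hS ht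
  | lam t ih => exact ih ht
  | app t s iht ihs => exact ⟨iht ht.1, ihs ht.2⟩
  | _ => trivial

theorem stacksIn_map_of_stackFree (f : P → Q) (S : Set Q) {t : Tm P} (ht : t.StackFree) :
    (t.map f).StacksIn S := by
  induction t with
  | stk p => exact ht.elim
  | lam t ih => exact ih ht
  | app t s iht ihs => exact ⟨iht ht.1, ihs ht.2⟩
  | _ => trivial

theorem StacksIn.rename {S : Set P} {t : Tm P} (ht : t.StacksIn S) (ρ : ℕ → ℕ) :
    (t.rename ρ).StacksIn S := by
  induction t generalizing ρ with
  | lam t ih => exact ih ht _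
  | app t s iht ihs => exact ⟨iht ht.1 _, ihs ht.2 _⟩
  | _ => exact ht

theorem StacksIn.subst {S : Set P} {t : Tm P} (ht : t.StacksIn S) {σ : ℕ → Tm P}
    (hσ : ∀ i, (σ i).StacksIn S) : (t.subst σ).StacksIn S := by
  induction t generalizing σ with
  | var i => exact hσ i
  | lam t ih =>
    refine ih ht fun i => ?_
    cases i with
    | zero => trivial
    | succ i => exact (hσ i).rename _
  | app t s iht ihs => exact ⟨iht ht.1 hσ, ihs ht.2 hσ⟩
  | _ => exact ht

theorem stacksIn_apps {S : Set P} {t : Tm P} {ts : List (Tm P)} :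
    (apps t ts).StacksIn S ↔ t.StacksIn S ∧ ∀ s ∈ ts, s.StacksIn S := by
  induction ts generalizing t with
  | nil => simp [apps]
  | cons s ts ih =>
    change (apps (app t s) ts).StacksIn S ↔ _
    simp [ih, StacksIn, and_assoc]

/-- Both rules only move, copy or erase subterms, so no stack constant is created. -/
theorem HeadStep.stacksIn {S : Set P} {t t' : Tm P} (h : HeadStep t t') (ht : t.StacksIn S) :
    t'.StacksIn S := by
  cases h with
  | beta u s ts =>
    rw [stacksIn_apps] at ht ⊢
    refine ⟨?_, ht.2⟩
    rw [inst_eq]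
    refine StacksIn.subst (t := u) ht.1.1 fun i => ?_
    cases i with
    | zero => exact ht.1.2
    | succ i => trivial
  | ctrl s ts =>
    rw [stacksIn_apps] at ht
    refine ⟨ht.1.2, ?_⟩
    change (apps _ _).StacksIn S
    rw [stacksIn_apps]
    refine ⟨trivial, fun s' hs' => ?_⟩
    obtain ⟨s', h, rfl⟩ := List.mem_map.1 hs'
    exact (ht.2 s' h).rename _

theorem HeadRed.stacksIn {S : Set P} {t t' : Tm P} (h : HeadRed t t') (ht : t.StacksIn S) :
    t'.StacksIn S := by
  induction h with
  | refl => exact ht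
  | tail _ h ih => exact h.stacksIn ih

end Tm

open Tm

variable {L : FirstOrder.Language.{u, v}}

theorem TypedC2.map {P Q : Type*} {E : Set (L.Term ℕ × L.Term ℕ)} (f : P → Q)
    {Γ : List (Ty L)} {t : Tm P} {A : Ty L} (h : TypedC2 E Γ t A) : TypedC2 E Γ (t.map f) A := by
  induction h with
  | ctrl Γ => exact .ctrl Γ
  | var h => exact .var h
  | lam _ ih => exact .lam ih
  | app _ _ iht ihs => exact .app iht ihs
  | all1_intro _ ih => exact .all1_intro ih
  | all1_elim a _ ih => exact .all1_elim a ih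
  | all2_intro _ ih => exact .all2_intro ih
  | all2_elim G _ ih => exact .all2_elim G ih
  | eqn h _ ih => exact .eqn h ih

/-! ## Realizability -/

section Realizability

variable {P : Type*} {M : Type*} [L.Structure M]

/-- Extension of a valuation of the individual variables by a value for the variable `0`. -/
def consI (a : M) (e : ℕ → M) : ℕ → M
  | 0 => a
  | i + 1 => e i

variable (P M) in
/-- Valuations of the predicate variables by falsity values. -/
abbrev PredVal := ∀ n : ℕ, ℕ → (Fin n → M) → Set (List (Tm P))

/-- Extension of a valuation by a value for the `n`-ary predicate variable `0`. -/
def consP (n : ℕ) (G : (Fin n → M) → Set (List (Tm P))) (F : PredVal P M) : PredVal P M :=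
  fun m k => if h : m = n then
      match k with
      | 0 => fun xs => G (fun i => xs (Fin.cast h.symm i))
      | j + 1 => F m j
    else F m k

/-- The falsity value of a formula: a set of stacks. -/
def falsity (pole : Set (Tm P)) : Ty L → (ℕ → M) → PredVal P M → Set (List (Tm P))
  | .bot, _, _ => {[]}
  | .rel _ _, _, _ => ∅
  | @Ty.pvar _ n X ts, e, F => F n X fun i => (ts i).realize e
  | .imp A B, e, F => {π | ∃ t π', π = t :: π' ∧ (∀ ρ ∈ falsity pole A e F, apps t ρ ∈ pole) ∧
      π' ∈ falsity pole B e F}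
  | .all1 A, e, F => {π | ∃ a, π ∈ falsity pole A (consI a e) F}
  | .all2 n A, e, F => {π | ∃ G, π ∈ falsity pole A e (consP n G F)}

/-- The term `t` realizes the formula `A`. -/
def Realizes (pole : Set (Tm P)) (t : Tm P) (A : Ty L) (e : ℕ → M) (F : PredVal P M) : Prop :=
  ∀ π ∈ falsity pole A e F, apps t π ∈ pole

variable {pole : Set (Tm P)}

/-! ### Falsity values under substitution -/

theorem realize_liftI (τ : ℕ → L.Term ℕ) (a : M) (e : ℕ → M) :
    (fun i => (Ty.liftI τ i).realize (consI a e)) = consI a fun i => (τ i).realize e := by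
  funext i
  cases i with
  | zero => rfl
  | succ i => simp only [Ty.liftI, FirstOrder.Language.Term.realize_relabel]; rfl

theorem falsity_isubst (A : Ty L) (τ : ℕ → L.Term ℕ) (e : ℕ → M) (F : PredVal P M) :
    falsity pole (A.isubst τ) e F = falsity pole A (fun i => (τ i).realize e) F := by
  induction A generalizing τ e F with
  | bot => rfl
  | rel => rfl
  | pvar X ts => simp [Ty.isubst, falsity, FirstOrder.Language.Term.realize_subst]
  | imp A B ihA ihB => simp [Ty.isubst, falsity, ihA, ihB]
  | all1 A ih => simp [Ty.isubst, falsity, ih, realize_liftI]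
  | all2 n A ih => simp [Ty.isubst, falsity, ih]

theorem falsity_ishift (A : Ty L) (a : M) (e : ℕ → M) (F : PredVal P M) :
    falsity pole A.ishift (consI a e) F = falsity pole A e F :=
  falsity_isubst _ _ _ _

theorem falsity_inst1 (A : Ty L) (a : L.Term ℕ) (e : ℕ → M) (F : PredVal P M) :
    falsity pole (A.inst1 a) e F = falsity pole A (consI (a.realize e) e) F := by
  rw [Ty.inst1, falsity_isubst]
  congr 1
  funext i
  cases i <;> rfl

theorem consP_comp_liftRenP (n : ℕ) (ρ : ℕ → ℕ → ℕ) (G : (Fin n → M) → Set (List (Tm P)))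
    (F : PredVal P M) :
    (fun m k => consP n G F m (Ty.liftRenP n ρ m k)) = consP n G fun m k => F m (ρ m k) := by
  funext m k
  by_cases h : m = n
  · subst h
    cases k <;> simp [consP, Ty.liftRenP]
  · simp [consP, Ty.liftRenP, h]

theorem falsity_prename (A : Ty L) (ρ : ℕ → ℕ → ℕ) (e : ℕ → M) (F : PredVal P M) :
    falsity pole (A.prename ρ) e F = falsity pole A e fun m k => F m (ρ m k) := by
  induction A generalizing ρ e F with
  | bot => rfl
  | rel => rfl
  | pvar X ts => rfl
  | imp A B ihA ihB => simp [Ty.prename, falsity, ihA, ihB]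
  | all1 A ih => simp [Ty.prename, falsity, ih]
  | all2 n A ih => simp [Ty.prename, falsity, ih, consP_comp_liftRenP]

theorem falsity_pshift (n : ℕ) (A : Ty L) (G : (Fin n → M) → Set (List (Tm P))) (e : ℕ → M)
    (F : PredVal P M) : falsity pole (A.pshift n) e (consP n G F) = falsity pole A e F := by
  rw [Ty.pshift, falsity_prename]
  congr 1
  funext m k
  by_cases h : m = n <;> simp [consP, Ty.succP, h]

/-- The valuation in which the `n` parameters of a predicate have the values `xs`. -/
def paramVal {n : ℕ} (xs : Fin n → M) (e : ℕ → M) : ℕ → M :=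
  fun i => if h : i < n then xs ⟨i, h⟩ else e (i - n)

theorem falsity_applyP {n : ℕ} (G : Ty L) (ts : Fin n → L.Term ℕ) (e : ℕ → M) (F : PredVal P M) :
    falsity pole (G.applyP ts) e F = falsity pole G (paramVal (fun i => (ts i).realize e) e) F := by
  rw [Ty.applyP, falsity_isubst]
  congr 1
  funext i
  by_cases h : i < n <;> simp [paramVal, h]

theorem falsity_idP (n k : ℕ) (xs : Fin n → M) (e : ℕ → M) (F : PredVal P M) :
    falsity pole (Ty.idP n k : Ty L) (paramVal xs e) F = F n k xs := by
  simp [Ty.idP, falsity, paramVal]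

variable (pole) in
/-- The valuation of the predicate variables given by a substitution of predicates. -/
def substVal (σ : ℕ → ℕ → Ty L) (e : ℕ → M) (F : PredVal P M) : PredVal P M :=
  fun m k xs => falsity pole (σ m k) (paramVal xs e) F

/-- Indices below the arity are parameters and stay fixed; the others are shifted past the new value
`a`. -/
theorem substVal_liftP1 (σ : ℕ → ℕ → Ty L) (a : M) (e : ℕ → M) (F : PredVal P M) :
    substVal pole (Ty.liftP1 σ) (consI a e) F = substVal pole σ e F := by
  funext m k xs
  rw [substVal, Ty.liftP1, falsity_isubst, substVal]
  congr 1
  funext i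
  by_cases h : i < m
  · simp [paramVal, h]
  · have h' : ¬ i + 1 < m := by omega
    have h'' : i + 1 - m = (i - m) + 1 := by omega
    simp [paramVal, h, h', h'', consI]

theorem substVal_liftP2 (n : ℕ) (σ : ℕ → ℕ → Ty L) (G : (Fin n → M) → Set (List (Tm P)))
    (e : ℕ → M) (F : PredVal P M) :
    substVal pole (Ty.liftP2 n σ) e (consP n G F) = consP n G (substVal pole σ e F) := by
  funext m k xs
  by_cases h : m = n
  · subst h
    cases k with
    | zero => simp [substVal, Ty.liftP2, falsity_idP, consP]
    | succ k => simp [substVal, Ty.liftP2, falsity_pshift, consP]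
  · simp [substVal, Ty.liftP2, falsity_pshift, consP, h]

theorem falsity_psubst (A : Ty L) (σ : ℕ → ℕ → Ty L) (e : ℕ → M) (F : PredVal P M) :
    falsity pole (A.psubst σ) e F = falsity pole A e (substVal pole σ e F) := by
  induction A generalizing σ e F with
  | bot => rfl
  | rel => rfl
  | pvar X ts => exact falsity_applyP _ _ _ _
  | imp A B ihA ihB => simp [Ty.psubst, falsity, ihA, ihB]
  | all1 A ih => simp [Ty.psubst, falsity, ih, substVal_liftP1]
  | all2 n A ih => simp [Ty.psubst, falsity, ih, substVal_liftP2]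

theorem falsity_inst2 (n : ℕ) (A G : Ty L) (e : ℕ → M) (F : PredVal P M) :
    falsity pole (Ty.inst2 n A G) e F =
      falsity pole A e (consP n (fun xs => falsity pole G (paramVal xs e) F) F) := by
  rw [Ty.inst2, falsity_psubst]
  congr 1
  funext m k xs
  by_cases h : m = n
  · subst h
    cases k <;> simp [substVal, falsity_idP, consP]
  · simp [substVal, falsity_idP, consP, h]

/-! ### Soundness of equations and typing rules -/

theorem EqCons.realize_eq {E : Set (L.Term ℕ × L.Term ℕ)}
    (hM : ∀ ab ∈ E, ∀ e : ℕ → M, ab.1.realize e = ab.2.realize e) {a b : L.Term ℕ}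
    (h : EqCons E a b) (e : ℕ → M) : a.realize e = b.realize e := by
  induction h with
  | ax h τ => simpa only [FirstOrder.Language.Term.realize_subst] using hM _ h _
  | refl => rfl
  | symm _ ih => exact ih.symm
  | trans _ _ ih ih' => exact ih.trans ih'
  | func f _ ih => simp [FirstOrder.Language.Term.realize, ih]

/-- For `π` in the falsity value of `X`, the continuation $\lambda x\,(x)\pi$ realizes `X.neg`:
applied to `u` it reduces to $(u)\pi$. As `bot` has only the empty stack, `t` applied to it is in
the pole. -/
theorem apps_app_C_mem (hpole : ∀ t t', HeadStep t t' → t' ∈ pole → t ∈ pole)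
    {t : Tm P} {X : Ty L} {e : ℕ → M} {F : PredVal P M} {π : List (Tm P)}
    (ht : Realizes pole t X.neg.neg e F) (hπ : π ∈ falsity pole X e F) :
    apps (app C t) π ∈ pole := by
  refine hpole _ _ (.ctrl t π) (ht [_] ⟨_, [], rfl, ?_, rfl⟩)
  rintro _ ⟨u, _, rfl, hu, rfl⟩
  refine hpole _ _ (.beta _ u []) ?_
  rw [inst_continuation]
  exact hu π hπ

/-- Adequacy of realizability with respect to the typing rules. -/
theorem TypedC2.realizes (hpole : ∀ t t', HeadStep t t' → t' ∈ pole → t ∈ pole)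
    {E : Set (L.Term ℕ × L.Term ℕ)}
    (hM : ∀ ab ∈ E, ∀ e : ℕ → M, ab.1.realize e = ab.2.realize e)
    {Γ : List (Ty L)} {t : Tm P} {A : Ty L} (h : TypedC2 E Γ t A) (e : ℕ → M) (F : PredVal P M)
    (σ : ℕ → Tm P) (hσ : ∀ i B, Γ[i]? = some B → Realizes pole (σ i) B e F) :
    Realizes pole (t.subst σ) A e F := by
  induction h generalizing e F σ with
  | ctrl Γ =>
    rintro _ ⟨G, t, π, rfl, ht, hπ⟩
    exact apps_app_C_mem hpole ht hπ
  | var h => exact hσ _ _ h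
  | lam _ ih =>
    rintro _ ⟨s, π, rfl, hs, hπ⟩
    refine hpole _ _ (.beta _ s π) ?_
    rw [inst_subst_liftSub]
    refine ih e F _ (fun i B hB => ?_) π hπ
    cases i with
    | zero =>
      obtain rfl : _ = B := by simpa using hB
      exact hs
    | succ i => exact hσ i B (by simpa using hB)
  | app _ _ iht ihs =>
    exact fun π hπ => iht e F σ hσ (_ :: π) ⟨_, π, rfl, ihs e F σ hσ, hπ⟩
  | all1_intro _ ih =>
    rintro π ⟨a, hπ⟩
    refine ih (consI a e) F σ (fun i B hB => ?_) π hπ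
    rw [List.getElem?_map, Option.map_eq_some_iff] at hB
    obtain ⟨B, hB, rfl⟩ := hB
    -- The freshness condition: shifted hypotheses do not see the new value.
    rw [Realizes, falsity_ishift]
    exact hσ i B hB
  | all1_elim a _ ih =>
    intro π hπ
    rw [falsity_inst1] at hπ
    exact ih e F σ hσ π ⟨_, hπ⟩
  | @all2_intro _ _ n _ _ ih =>
    rintro π ⟨G, hπ⟩
    refine ih e (consP n G F) σ (fun i B hB => ?_) π hπ
    rw [List.getElem?_map, Option.map_eq_some_iff] at hB
    obtain ⟨B, hB, rfl⟩ := hB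
    rw [Realizes, falsity_pshift]
    exact hσ i B hB
  | all2_elim G _ ih =>
    intro π hπ
    rw [falsity_inst2] at hπ
    exact ih e F σ hσ π ⟨_, hπ⟩
  | eqn h _ ih =>
    intro π hπ
    rw [falsity_inst1, ← h.realize_eq hM, ← falsity_inst1] at hπ
    exact ih e F σ hσ π hπ

end Realizability

/-! ## The model of individual terms modulo the equations -/

/-- Equational consequence as a setoid. -/
def eqConsSetoid (E : Set (L.Term ℕ × L.Term ℕ)) : Setoid (L.Term ℕ) :=
  ⟨EqCons E, .refl, .symm, .trans⟩

/-- Individual terms modulo the equations `E`. -/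
def TermModel (E : Set (L.Term ℕ × L.Term ℕ)) :=
  Quotient (eqConsSetoid E)

namespace TermModel

variable {E : Set (L.Term ℕ × L.Term ℕ)}

/-- The class of a term. -/
def mk (E : Set (L.Term ℕ × L.Term ℕ)) (a : L.Term ℕ) : TermModel E :=
  Quotient.mk (eqConsSetoid E) a

/-- A representative of a class of terms. -/
noncomputable def out (a : TermModel E) : L.Term ℕ :=
  Quotient.out a

theorem mk_out (a : TermModel E) : mk E a.out = a :=
  Quotient.out_eq a

theorem mk_eq_mk {a b : L.Term ℕ} : mk E a = mk E b ↔ EqCons E a b :=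
  Quotient.eq

theorem eqCons_out_mk (a : L.Term ℕ) : EqCons E (mk E a).out a :=
  mk_eq_mk.1 (mk_out _)

/-- `falsity` ignores relation symbols, so their interpretation is arbitrary. -/
noncomputable instance : L.Structure (TermModel E) where
  funMap f xs := mk E (.func f fun i => (xs i).out)
  RelMap _ _ := False

theorem realize_eq (a : L.Term ℕ) (e : ℕ → TermModel E) :
    a.realize e = mk E (a.subst fun i => (e i).out) := by
  induction a with
  | var i => exact (mk_out _).symm
  | func f as ih =>
    refine mk_eq_mk.2 (.func f fun i => ?_)
    simp only [ih]
    exact eqCons_out_mk _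

theorem realize_eq_of_mem (ab : L.Term ℕ × L.Term ℕ) (h : ab ∈ E) (e : ℕ → TermModel E) :
    ab.1.realize e = ab.2.realize e := by
  rw [realize_eq, realize_eq, mk_eq_mk]
  exact .ax h _

end TermModel

theorem numeral_subst (zero : L.Constants) (succ : L.Functions 1) (n : ℕ) (τ : ℕ → L.Term ℕ) :
    (numeral zero succ n).subst τ = numeral zero succ n := by
  induction n with
  | zero =>
    simp only [numeral, FirstOrder.Language.Constants.term, FirstOrder.Language.Term.subst]
    congr 1
    funext i
    exact i.elim0
  | succ n ih =>
    simp only [numeral, FirstOrder.Language.Functions.apply₁, FirstOrder.Language.Term.subst]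
    congr 1
    funext i
    fin_cases i
    exact ih

theorem TermModel.realize_numeral (E : Set (L.Term ℕ × L.Term ℕ)) (zero : L.Constants)
    (succ : L.Functions 1) (n : ℕ) (e : ℕ → TermModel E) :
    (numeral zero succ n).realize e = mk E (numeral zero succ n) := by
  rw [realize_eq, numeral_subst]

/-- Both halves of adequacy enter: $s(a)\not\approx 0$ excludes `n = 0`, and injectivity of $s$
modulo `E` identifies `a` with the preceding numeral. -/
theorem Adequate.exists_of_realize_succ {zero : L.Constants} {succ : L.Functions 1}
    {E : Set (L.Term ℕ × L.Term ℕ)} (hE : Adequate zero succ E) {a : TermModel E}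
    {e : ℕ → TermModel E} {n : ℕ}
    (h : (succ.apply₁ (FirstOrder.Language.Term.var 0)).realize (consI a e) =
      TermModel.mk E (numeral zero succ n)) :
    ∃ k, n = k + 1 ∧ a = TermModel.mk E (numeral zero succ k) := by
  have h' : EqCons E (succ.apply₁ a.out) (numeral zero succ n) := by
    rw [TermModel.realize_eq, TermModel.mk_eq_mk] at h
    convert h using 1
    simp only [FirstOrder.Language.Functions.apply₁, FirstOrder.Language.Term.subst]
    congr 1
    funext i
    fin_cases i
    rfl
  cases n with
  | zero => exact (hE.1 _ h').elim
  | succ k => exact ⟨k, rfl, by rw [← TermModel.mk_eq_mk.2 (hE.2 _ _ h'), TermModel.mk_out]⟩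

/-! ## Runs of classical integers -/

/-- The terms whose execution calls `g` with stack constants of positive value until it reaches `x`
with a stack constant of value `0`.  The stack constants are pairs formed by a value and a label. -/
inductive Countdown (x g : ℕ) : Tm (ℕ × ℕ) → Prop
  | zero {t : Tm (ℕ × ℕ)} {b : ℕ} : HeadRed t (app (var x) (stk (0, b))) → Countdown x g t
  | succ {t s : Tm (ℕ × ℕ)} {k b : ℕ} : HeadRed t (apps (var g) [s, stk (k + 1, b)]) →
      (∀ c, Countdown x g (app s (stk (k, c)))) → Countdown x g t

/-- The only condition that `TypedC2.realizes` puts on the pole. -/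
theorem Countdown.of_headStep {x g : ℕ} {t t' : Tm (ℕ × ℕ)} (h : HeadStep t t')
    (ht : Countdown x g t') : Countdown x g t := by
  cases ht with
  | zero h' => exact .zero (.head h h')
  | succ h' hs => exact .succ (.head h h') hs

theorem TypedC2.countdown {zero : L.Constants} {succ : L.Functions 1}
    {E : Set (L.Term ℕ × L.Term ℕ)} (hE : Adequate zero succ E) {n : ℕ} {θ : Tm (ℕ × ℕ)}
    (hθ : TypedC2 E [] θ (natTy zero succ (numeral zero succ n))) (x g b : ℕ) :
    Countdown x g (apps θ [Tm.var x, Tm.var g, stk (n, b)]) := by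
  -- The type is closed, so the valuations are arbitrary; only the value `G` of its bound `X`
  -- matters.
  let e : ℕ → TermModel E := fun i => TermModel.mk E (.var i)
  let G : (Fin 1 → TermModel E) → Set (List (Tm (ℕ × ℕ))) :=
    fun xs => {π | ∃ k c, π = [stk (k, c)] ∧ xs 0 = TermModel.mk E (numeral zero succ k)}
  have h := hθ.realizes (pole := {t | Countdown x g t}) (fun _ _ => Countdown.of_headStep)
    TermModel.realize_eq_of_mem e (fun _ _ _ => ∅) Tm.var (by simp)
  rw [subst_var] at h
  refine h [Tm.var x, Tm.var g, stk (n, b)] ⟨G, _, _, rfl, ?_, _, _, rfl, ?_, ?_⟩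
  · rintro _ ⟨k, c, rfl, hk⟩
    cases k with
    | zero => exact .zero .refl
    | succ k =>
      -- A positive value is impossible, as $0\not\approx s(s^k(0))$.
      have hk' : (numeral zero succ 0).realize e = _ := hk
      rw [TermModel.realize_numeral, TermModel.mk_eq_mk] at hk'
      exact (hE.1 _ hk'.symm).elim
  · rintro _ ⟨a, s, _, rfl, hs, k, c, rfl, hk⟩
    obtain ⟨k, rfl, rfl⟩ := hE.exists_of_realize_succ hk
    exact .succ .refl fun c => hs _ ⟨k, c, rfl, rfl⟩
  · exact ⟨n, b, rfl, TermModel.realize_numeral _ _ _ _ _⟩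

/-- The run of a term in `Countdown`, when its stack constants are labelled by the steps at which
they were introduced and the current step is `i`. -/
theorem Countdown.exists_run {x g : ℕ} {t : Tm (ℕ × ℕ)} (ht : Countdown x g t) (i : ℕ) (I : ℕ → ℕ)
    (hS : t.StacksIn {q | q.2 ≤ i ∧ q.1 = I q.2}) :
    ∃ m, i ≤ m ∧ ∃ (J r : ℕ → ℕ) (T U : ℕ → Tm (ℕ × ℕ)),
      (∀ j ≤ i, J j = I j) ∧ U i = t ∧ (∀ j, i < j → U j = app (T j) (stk (J j, j))) ∧
      (∀ j, i ≤ j → j ≤ m → r j ≤ j) ∧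
      (∀ j, i ≤ j → j < m → J (r j) = J (j + 1) + 1 ∧
        HeadRed (U j) (apps (var g) [T (j + 1), stk (J (r j), r j)])) ∧
      J (r m) = 0 ∧ HeadRed (U m) (app (var x) (stk (J (r m), r m))) := by
  induction ht generalizing i I with
  | @zero t b h =>
    -- The constant passed to $x$ already occurs in `t`, so its label is at most `i` and its value
    -- is given by `I`.
    obtain ⟨-, hb, hI⟩ := h.stacksIn hS
    simp only at hb hI
    refine ⟨i, le_rfl, I, fun _ => b, fun _ => C,
      fun j => if j = i then t else app C (stk (I j, j)), fun _ _ => rfl, by simp,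
      fun j hj => by simp [hj.ne'], fun j hj _ => hb.trans hj, fun j hj hj' => by omega, hI.symm, ?_⟩
    simpa [← hI] using h
  | @succ t s k b h _ ih =>
    obtain ⟨⟨-, hs⟩, hb, hI⟩ := h.stacksIn hS
    simp only at hb hI
    have hupd : ∀ j ≤ i, Function.update I (i + 1) k j = I j := fun j hj =>
      Function.update_of_ne (by omega) _ _
    have hsub : {q : ℕ × ℕ | q.2 ≤ i ∧ q.1 = I q.2} ⊆
        {q | q.2 ≤ i + 1 ∧ q.1 = Function.update I (i + 1) k q.2} := fun q hq =>
      ⟨hq.1.trans i.le_succ, hq.2.trans (hupd _ hq.1).symm⟩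
    -- The first `i + 1` is the fresh label, of value `k`, chosen for the next constant; the second
    -- is the next step.
    obtain ⟨m, hm, J, r, T, U, hJ, hU, hUT, hr, hstep, hlast⟩ :=
      ih (i + 1) (i + 1) (Function.update I (i + 1) k) ⟨hs.mono hsub, le_rfl, by simp⟩
    have hJi : J (i + 1) = k := by simpa using hJ (i + 1) le_rfl
    have hJb : J b = k + 1 := by rw [hJ b (by omega), hupd b hb, hI]
    -- The tail of the run leaves `r i`, `T (i + 1)` and `U i` unconstrained, so they can be set to
    -- the data of this step.
    refine ⟨m, by omega, J, Function.update r i b, Function.update T (i + 1) s,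
      Function.update U i t, fun j hj => (hJ j (by omega)).trans (hupd j hj), by simp, fun j hj => ?_,
      fun j hj hjm => ?_, fun j hj hjm => ?_, ?_⟩
    · rw [Function.update_of_ne (by omega)]
      rcases eq_or_ne j (i + 1) with rfl | hne
      · rw [Function.update_self, hU, hJi]
      · rw [Function.update_of_ne hne, hUT j (by omega)]
    · rcases eq_or_ne j i with rfl | hne
      · rwa [Function.update_self]
      · rw [Function.update_of_ne hne]
        exact hr j (by omega) hjm
    · rcases eq_or_ne j i with rfl | hne
      · rw [Function.update_self, Function.update_self, Function.update_self, hJb, hJi]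
        exact ⟨rfl, h⟩
      · rw [Function.update_of_ne hne, Function.update_of_ne hne,
          Function.update_of_ne (by omega)]
        exact hstep j (by omega) hjm
    · rw [Function.update_of_ne (by omega), Function.update_of_ne (by omega)]
      exact hlast

end MixedLogic

/-! ### The theorem on classical integers -/

open MixedLogic MixedLogic.Tm in
theorem theorem5p4 {L : FirstOrder.Language.{u, v}} (zero : L.Constants) (succ : L.Functions 1)
    (E : Set (L.Term ℕ × L.Term ℕ)) (hE : Adequate zero succ E)
    {P : Type w} [Infinite P]
    (n : ℕ) (θ : Tm P) (hθ : IsClassicalInteger zero succ E n θ)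
    (x g : ℕ) (hxg : x ≠ g) :
    (n = 0 → ∀ p : P, HeadRed (apps θ [var x, var g, stk p]) (app (var x) (stk p))) ∧
    (n ≠ 0 → ∃ m : ℕ, 1 ≤ m ∧ ∃ I r : ℕ → ℕ,
      (∀ i ≤ m, r i ≤ m) ∧
      I 0 = n ∧ I (r m) = 0 ∧ (∀ i < m, 1 ≤ I (r i) ∧ I (i + 1) = I (r i) - 1) ∧
      ∀ p : ℕ → P, Set.InjOn p (Set.Iic m) → ∃ t : ℕ → Tm P,
        HeadRed (apps θ [var x, var g, stk (p 0)]) (apps (var g) [t 1, stk (p (r 0))]) ∧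
        (∀ i, 1 ≤ i → i ≤ m - 1 →
          HeadRed (app (t i) (stk (p i))) (apps (var g) [t (i + 1), stk (p (r i))])) ∧
        HeadRed (app (t m) (stk (p m))) (app (var x) (stk (p (r m))))) := by
  obtain ⟨hfree, -, htyped⟩ := hθ
  -- The choice is immaterial, since `θ` has no stack constants.
  let f : P → ℕ × ℕ := fun _ => (0, 0)
  obtain ⟨m, -, J, r, T, U, hJ, hU, hUT, hr, hstep, hlast, hend⟩ :=
    ((htyped.map f).countdown hE x g 0).exists_run 0 (fun _ => n) <| by
      rw [stacksIn_apps]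
      refine ⟨stacksIn_map_of_stackFree f _ hfree, ?_⟩
      simp [Tm.StacksIn]
  have hJ0 : J 0 = n := hJ 0 le_rfl
  have hU0 : ∀ p : ℕ → P,
      (U 0).map (fun q => p q.2) = apps θ [var x, var g, stk (p 0)] := fun p => by
    rw [hU, map_apps, map_map_of_stackFree _ _ hfree]
    rfl
  have hUT' : ∀ (p : ℕ → P) j, 0 < j →
      (U j).map (fun q => p q.2) = app ((T j).map fun q => p q.2) (stk (p j)) := fun p j hj => by
    rw [hUT j hj]
    rfl
  refine ⟨?_, fun hn => ?_⟩
  · rintro rfl p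
    -- A call of $g$ at step `0` could only receive label `0`, of value `0`, but a call needs a
    -- positive value.
    obtain rfl : m = 0 := by
      by_contra hm
      have h := (hstep 0 le_rfl (Nat.pos_of_ne_zero hm)).1
      rw [Nat.le_zero.1 (hr 0 le_rfl (Nat.zero_le m)), hJ0] at h
      omega
    have h := hend.map fun _ => p
    rwa [hU0 fun _ => p] at h
  -- If `m = 0`, then $x$ receives label `0`, whose value `n` would be `0`.
  · have hm : 1 ≤ m := by
      by_contra hm
      obtain rfl : m = 0 := by omega
      rw [Nat.le_zero.1 (hr 0 le_rfl le_rfl), hJ0] at hlast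
      exact hn hlast
    refine ⟨m, hm, J, r, ?_, hJ0, hlast, fun i hi => ?_, fun p _ =>
      ⟨fun i => (T i).map fun q => p q.2, ?_, fun i hi him => ?_, ?_⟩⟩
    · exact fun i hi => (hr i (Nat.zero_le i) hi).trans hi
    · have h := (hstep i (Nat.zero_le i) hi).1
      omega
    · have h := (hstep 0 le_rfl hm).2.map fun q => p q.2
      rwa [hU0 p] at h
    · have h := (hstep i (Nat.zero_le i) (by omega)).2.map fun q => p q.2
      rwa [hUT' p i hi] at h
    · have h := hend.map fun q => p q.2
      rwa [hUT' p m hm] at h
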